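/- Let $G$ be a compact Lie group, $K\subset G$ a closed subgroup, and let $(\tau,E_0)$, $(\rho,F_0)$ be finite-dimensional unitary representations of $K$ (in particular, they may be irreducible). Let $E=G\times_\tau E_0$ and $F=G\times_\rho F_0$ be the associated homogeneous vector bundles over $G/K$, and identify $\Gamma(E)$ with the space of smooth maps $u:G\to E_0$ such that $u(gk)=\tau(k)^{-1}u(g)$ for all $g\in G$, $k\in K$; similarly for $\Gamma(F)$. Let $A:\Gamma(E)\to\Gamma(F)$ be a linear operator that is continuous for the $C^\infty$ topologies. For $u\in C^\infty(G,E_0)$ let $Pu\in\Gamma(E)$ be its projection $Pu(g)=\int_K\tau(k)u(gk)\,dk$ ($dk$ the normalized Haar measure of $K$; $Pu=u$ if $u\in\Gamma(E)$), and extend $A$ to all of $C^\infty(G,E_0)$ by $Au:=A(Pu)$. Let $K_A(x,y)$ be the $\operatorname{Hom}(E_0,F_0)$-valued Schwartz kernel of $A$, pulled back to $G\times G$: for fixed $x$ it is the distribution in $y$ with $$\int_G K_A(x,y)u(y)\,dy=(Au)(x)\qquad(u\in C^\infty(G,E_0)),$$ so that $K_A(x,yk)=K_A(x,y)\tau(k)$.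 Let $R_A(x,z)=K_A(x,xz^{-1})$ be the right convolution kernel of $A$, so that $Au(x)=\int_G R_A(x,y^{-1}x)u(y)\,dy$. For a finite-dimensional (e.g. irreducible) unitary representation $\lambda:G\to U(\mathcal H_\lambda)$ and $x\in G$, the symbol of $A$ is the Fourier coefficient of the right convolution kernel, $$\sigma_A(\lambda,x)=\int_G\lambda(z)^*\otimes R_A(x,z)\,dz\ \in\ \operatorname{End}(\mathcal H_\lambda)\otimes\operatorname{Hom}(E_0,F_0),$$ in the sense of distributions. Fix orthonormal bases $\{e_a\}$ of $E_0$, $\{f_b\}$ of $F_0$ and $\{h_m\}$ of $\mathcal H_\lambda$, write $\lambda_{mn}(x)=\langle h_m,\lambda(x)h_n\rangle$, and let $\sigma_A(\lambda,x)_{ab}\in\operatorname{End}(\mathcal H_\lambda)$ be the image of $\sigma_A(\lambda,x)$ under $S\otimes T\mapsto\langle f_b,Te_a\rangle S$. Then, for all $x$, $a$, $b$, $$\sigma_A(\lambda,x)_{ab}=(\lambda(x)^*\otimes f_b^*)\,A(\lambda(x)\otimes e_a),$$ where $A$ is applied entrywise to the matrix coefficients of $\lambda$; that is, for all $m,n$,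 $$\langle h_m,\sigma_A(\lambda,x)_{ab}h_n\rangle=\sum_{\alpha}\overline{\lambda_{\alpha m}(x)}\;f_b^*\big(A(\lambda_{\alpha n}\,e_a)(x)\big).$$ -/

import Mathlib

/-!
Symbols of operators between homogeneous vector bundles over `G/K`.

The first block proves that an integral over a compact space of a function depending smoothly on a
parameter in a manifold is smooth; it is used for averaging over `K` and for the smoothness of
matrix coefficients.
-/

open MeasureTheory Topology
open scoped Manifold ContDiff TensorProduct InnerProductSpace Matrix

theorem integrable_of_continuous_compact {T Y : Type*} [TopologicalSpace T] [CompactSpace T]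
    [MeasurableSpace T] [OpensMeasurableSpace T] (μ : Measure T) [IsFiniteMeasure μ]
    [NormedAddCommGroup Y] {h : T → Y} (hh : Continuous h) : Integrable h μ := by
  rw [← integrableOn_univ]
  exact hh.continuousOn.integrableOn_compact' isCompact_univ MeasurableSet.univ

theorem integral_clm_apply_compact {𝔼 T Y : Type*} [NormedAddCommGroup 𝔼] [NormedSpace ℝ 𝔼]
    [TopologicalSpace T] [CompactSpace T]
    [MeasurableSpace T] [OpensMeasurableSpace T] (μ : Measure T) [IsFiniteMeasure μ]
    [NormedAddCommGroup Y] [NormedSpace ℝ Y] {L : T → 𝔼 →L[ℝ] Y} (hL : Continuous L) (v : 𝔼) :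
    (∫ t, L t ∂μ) v = ∫ t, L t v ∂μ ∧ Integrable (fun t => L t v) μ :=
  have h := integrable_of_continuous_compact μ hL
  ⟨ContinuousLinearMap.integral_apply h v, h.apply_continuousLinearMap v⟩

theorem hasFDerivAt_integral_compact {𝔼 X T : Type*} [NormedAddCommGroup 𝔼] [NormedSpace ℝ 𝔼]
    [FiniteDimensional ℝ 𝔼] [NormedAddCommGroup X] [NormedSpace ℝ X]
    [TopologicalSpace T] [CompactSpace T] [MeasurableSpace T] [OpensMeasurableSpace T]
    (μ : Measure T) [IsFiniteMeasure μ] {U : Set 𝔼} (hU : IsOpen U)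
    {f : 𝔼 → T → X} {f' : 𝔼 → T → 𝔼 →L[ℝ] X}
    (hf : ContinuousOn (fun p : 𝔼 × T => f p.1 p.2) (U ×ˢ Set.univ))
    (hf' : ContinuousOn (fun p : 𝔼 × T => f' p.1 p.2) (U ×ˢ Set.univ))
    (hd : ∀ t, ∀ s ∈ U, HasFDerivAt (fun s => f s t) (f' s t) s) {s₀ : 𝔼} (hs : s₀ ∈ U) :
    HasFDerivAt (fun s => ∫ t, f s t ∂μ) (∫ t, f' s₀ t ∂μ) s₀ := by
  have : ProperSpace 𝔼 := FiniteDimensional.proper ℝ 𝔼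
  obtain ⟨r, hr, hrU⟩ := Metric.nhds_basis_closedBall.mem_iff.1 (hU.mem_nhds hs)
  have hK : IsCompact (Metric.closedBall s₀ r ×ˢ (Set.univ : Set T)) :=
    (isCompact_closedBall s₀ r).prod isCompact_univ
  obtain ⟨C, hC⟩ := hK.exists_bound_of_continuousOn
    (hf'.mono (Set.prod_mono hrU (subset_refl _)))
  have c1 : ∀ s ∈ U, Continuous (f s) := fun s hsU =>
    hf.comp_continuous (f := fun t => (s, t)) (by fun_prop) (fun t => ⟨hsU, trivial⟩)
  have c2 : ∀ s ∈ U, Continuous (f' s) := fun s hsU =>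
    hf'.comp_continuous (f := fun t => (s, t)) (by fun_prop) (fun t => ⟨hsU, trivial⟩)
  refine hasFDerivAt_integral_of_dominated_of_fderiv_le (bound := fun _ => C)
    (Metric.ball_mem_nhds s₀ hr) ?_ (integrable_of_continuous_compact μ (c1 s₀ hs)) ?_ ?_ (integrable_const C) ?_
  · filter_upwards [hU.mem_nhds hs] with s hsU
    exact (integrable_of_continuous_compact μ (c1 s hsU)).aestronglyMeasurable
  · exact (integrable_of_continuous_compact μ (c2 s₀ hs)).aestronglyMeasurable
  · exact Filter.Eventually.of_forall fun t s hsB => hC (s, t) ⟨Metric.ball_subset_closedBall hsB, trivial⟩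
  · exact Filter.Eventually.of_forall fun t s hsB =>
      hd t s (hrU (Metric.ball_subset_closedBall hsB))

theorem contDiffOn_integral_compact {𝔼 X T : Type*} [NormedAddCommGroup 𝔼] [NormedSpace ℝ 𝔼]
    [FiniteDimensional ℝ 𝔼] [NormedAddCommGroup X] [NormedSpace ℝ X] [CompleteSpace X]
    [TopologicalSpace T] [CompactSpace T] [MeasurableSpace T] [OpensMeasurableSpace T]
    (μ : Measure T) [IsFiniteMeasure μ] {U : Set 𝔼} (hU : IsOpen U)
    {F : 𝔼 → T → X} (hF : ∀ t, ContDiffOn ℝ ∞ (fun s => F s t) U)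
    (hc : ∀ m : ℕ, ContinuousOn
      (fun p : 𝔼 × T => iteratedFDerivWithin ℝ m (fun s => F s p.2) U p.1) (U ×ˢ Set.univ)) :
    ContDiffOn ℝ ∞ (fun s => ∫ t, F s t ∂μ) U := by
  have hD : ∀ m : ℕ, ∀ s₀ ∈ U, HasFDerivAt
      (fun s => ∫ t, iteratedFDerivWithin ℝ m (fun s => F s t) U s ∂μ)
      (∫ t, (iteratedFDerivWithin ℝ (m+1) (fun s => F s t) U s₀).curryLeft ∂μ) s₀ := by
    intro m s₀ hs
    refine hasFDerivAt_integral_compact μ hU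
      (f := fun s t => iteratedFDerivWithin ℝ m (fun s => F s t) U s)
      (f' := fun s t => (iteratedFDerivWithin ℝ (m+1) (fun s => F s t) U s).curryLeft)
      (hc m) ?_ ?_ hs
    · exact (continuousMultilinearCurryLeftEquiv ℝ (fun _ : Fin (m+1) => 𝔼) X).continuous.comp_continuousOn
        (hc (m+1))
    · intro t s hsU
      have := ((hF t).ftaylorSeriesWithin hU.uniqueDiffOn).fderivWithin m
        (by exact_mod_cast WithTop.coe_lt_coe.2 (ENat.natCast_lt_top m)) s hsU
      exact this.hasFDerivAt (hU.mem_nhds hsU)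
  have hE : ∀ m : ℕ, ∀ s₀ ∈ U, ∀ v : 𝔼,
      (∫ t, (iteratedFDerivWithin ℝ (m+1) (fun s => F s t) U s₀).curryLeft ∂μ) v =
        (∫ t, (iteratedFDerivWithin ℝ (m+1) (fun s => F s t) U s₀).curryLeft v ∂μ) ∧
      Integrable (fun t => (iteratedFDerivWithin ℝ (m+1) (fun s => F s t) U s₀).curryLeft v) μ := by
    intro m s₀ hs v
    refine integral_clm_apply_compact μ (L := fun t =>
      (iteratedFDerivWithin ℝ (m+1) (fun s => F s t) U s₀).curryLeft) ?_ v
    exact (continuousMultilinearCurryLeftEquiv ℝ (fun _ : Fin (m+1) => 𝔼) X).continuous.comp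
      ((hc (m+1)).comp_continuous (f := fun t => (s₀, t)) (by fun_prop) (fun t => ⟨hs, trivial⟩))
  have int : ∀ m : ℕ, ∀ s ∈ U, Integrable
      (fun t => iteratedFDerivWithin ℝ m (fun s => F s t) U s) μ := by
    intro m s hs
    have : Continuous (fun t => iteratedFDerivWithin ℝ m (fun s => F s t) U s) :=
      (hc m).comp_continuous (f := fun t => (s, t)) (by fun_prop) (fun t => ⟨hs, trivial⟩)
    exact integrable_of_continuous_compact μ this
  have hT : HasFTaylorSeriesUpToOn ∞ (fun s => ∫ t, F s t ∂μ)
      (fun s m => ∫ t, iteratedFDerivWithin ℝ m (fun s => F s t) U s ∂μ) U := by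
    constructor
    · intro s hs
      have := ((continuousMultilinearCurryFin0 ℝ 𝔼 X).toContinuousLinearEquiv.toContinuousLinearMap).integral_comp_comm (int 0 s hs)
      exact this.symm.trans (by congr 1)
    · intro m _ s hs
      have h := (hD m s hs).hasFDerivWithinAt (s := U)
      have e : (∫ t, (iteratedFDerivWithin ℝ (m+1) (fun s => F s t) U s).curryLeft ∂μ) =
          (∫ t, iteratedFDerivWithin ℝ (m+1) (fun s => F s t) U s ∂μ).curryLeft := by
        ext v u
        obtain ⟨e1, e2⟩ := hE m s hs v
        rw [e1, ContinuousMultilinearMap.integral_apply e2,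
          ContinuousMultilinearMap.curryLeft_apply,
          ContinuousMultilinearMap.integral_apply (int (m+1) s hs)]
        rfl
      rw [e] at h
      exact h
    · intro m _ s hs
      exact (hD m s hs).continuousAt.continuousWithinAt
  exact hT.contDiffOn

theorem continuousOn_iteratedFDerivWithin_param {𝔼 𝔽 V W T : Type*} [NormedAddCommGroup 𝔼] [NormedSpace ℝ 𝔼]
    [NormedAddCommGroup 𝔽] [NormedSpace ℝ 𝔽] [NormedAddCommGroup V] [NormedSpace ℝ V]
    [NormedAddCommGroup W] [NormedSpace ℝ W]
    [TopologicalSpace T] {U : Set 𝔼} (hU : IsOpen U) {O : Set 𝔽} (hO : IsOpen O)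
    {w : 𝔼 × 𝔽 → V} (hw : ContDiffOn ℝ ∞ w (U ×ˢ O)) {S : Set T} {η : T → 𝔽}
    (hη : ContinuousOn η S) (hηO : ∀ t ∈ S, η t ∈ O) {c : T → V →L[ℝ] W} (hcc : Continuous c) (m : ℕ) :
    ContinuousOn (fun p : 𝔼 × T => iteratedFDerivWithin ℝ m (fun s => c p.2 (w (s, η p.2))) U p.1)
      (U ×ˢ S) := by
  have key : ∀ p ∈ U ×ˢ S, iteratedFDerivWithin ℝ m (fun s => c p.2 (w (s, η p.2))) U p.1 =
      (c p.2).compContinuousMultilinearMap ((iteratedFDerivWithin ℝ m w (U ×ˢ O) (p.1, η p.2)).compContinuousLinearMap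
        (fun _ => ContinuousLinearMap.inl ℝ 𝔼 𝔽)) := by
    rintro ⟨s, t⟩ ⟨hs, ht⟩
    have ht' := hηO t ht
    set a : 𝔼 × 𝔽 := (0, η t) with ha
    have hP : IsOpen (U ×ˢ O) := hU.prod hO
    have hQ : IsOpen ((fun z => z + a) ⁻¹' (U ×ˢ O)) := hP.preimage (by fun_prop)
    have hpre : (ContinuousLinearMap.inl ℝ 𝔼 𝔽) ⁻¹' ((fun z => z + a) ⁻¹' (U ×ˢ O)) = U := by
      ext y; simp [ha, ht']
    have hwa : ContDiffOn ℝ ∞ (fun z => w (z + a)) ((fun z => z + a) ⁻¹' (U ×ˢ O)) :=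
      hw.comp (by fun_prop) (fun z hz => hz)
    have h1 := (ContinuousLinearMap.inl ℝ 𝔼 𝔽).iteratedFDerivWithin_comp_right hwa
      hQ.uniqueDiffOn (by rw [hpre]; exact hU.uniqueDiffOn) (x := s)
      (by simpa [ha] using ⟨hs, ht'⟩) (i := m) (by exact_mod_cast le_top)
    rw [hpre] at h1
    have h2 : ((fun z => w (z + a)) ∘ (ContinuousLinearMap.inl ℝ 𝔼 𝔽)) = fun s => w (s, η t) := by
      funext y; simp [ha]
    rw [h2] at h1
    have hws : ContDiffOn ℝ ∞ (fun s => w (s, η t)) U :=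
      hw.comp (by fun_prop) (fun z hz => ⟨hz, ht'⟩)
    have h3 := (c t).iteratedFDerivWithin_comp_left (i := m) (hws s hs) hU.uniqueDiffOn hs
      (by exact_mod_cast le_top)
    have h4 : iteratedFDerivWithin ℝ m (fun z => w (z + a)) ((fun z => z + a) ⁻¹' (U ×ˢ O))
        (ContinuousLinearMap.inl ℝ 𝔼 𝔽 s) = iteratedFDerivWithin ℝ m w (U ×ˢ O) (s, η t) := by
      rw [iteratedFDerivWithin_of_isOpen m hQ (by simpa [ha] using ⟨hs, ht'⟩),
        iteratedFDerivWithin_of_isOpen m hP (show (s, η t) ∈ U ×ˢ O from ⟨hs, ht'⟩),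
        iteratedFDeriv_comp_add_right]
      simp [ha]
    rw [h4] at h1
    rw [h1] at h3
    exact h3
  refine ContinuousOn.congr ?_ key
  have k1 : ContinuousOn (fun p : 𝔼 × T => iteratedFDerivWithin ℝ m w (U ×ˢ O) (p.1, η p.2))
      (U ×ˢ S) :=
    (hw.continuousOn_iteratedFDerivWithin (by exact_mod_cast le_top)
      (hU.prod hO).uniqueDiffOn).comp
      (continuousOn_fst.prodMk (hη.comp continuousOn_snd fun p hp => hp.2))
      (fun p hp => ⟨hp.1, hηO _ hp.2⟩)
  have k2 := (ContinuousMultilinearMap.compContinuousLinearMapL (F := V) (𝕜 := ℝ)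
    (fun _ : Fin m => ContinuousLinearMap.inl ℝ 𝔼 𝔽)).continuous.comp_continuousOn k1
  have k3 : ContinuousOn (fun p : 𝔼 × T => ContinuousLinearMap.compContinuousMultilinearMapL ℝ
      (fun _ : Fin m => 𝔼) V W (c p.2)) (U ×ˢ S) :=
    ((ContinuousLinearMap.compContinuousMultilinearMapL ℝ
      (fun _ : Fin m => 𝔼) V W).continuous.comp (hcc.comp continuous_snd)).continuousOn
  exact k3.clm_apply k2

theorem contMDiff_integral_compact {𝔼 G V W T : Type*} [NormedAddCommGroup 𝔼] [NormedSpace ℝ 𝔼]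
    [FiniteDimensional ℝ 𝔼] [TopologicalSpace G] [ChartedSpace 𝔼 G] [IsManifold 𝓘(ℝ, 𝔼) ∞ G]
    [NormedAddCommGroup V] [NormedSpace ℝ V]
    [NormedAddCommGroup W] [NormedSpace ℝ W] [CompleteSpace W]
    [TopologicalSpace T] [CompactSpace T] [MeasurableSpace T] [OpensMeasurableSpace T]
    (μ : Measure T) [IsFiniteMeasure μ] {Φ : G × G → V}
    (hΦ : ContMDiff (𝓘(ℝ, 𝔼).prod 𝓘(ℝ, 𝔼)) 𝓘(ℝ, V) ∞ Φ) {ι : T → G} (hι : Continuous ι)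
    {c : T → V →L[ℝ] W} (hc : Continuous c) :
    ContMDiff 𝓘(ℝ, 𝔼) 𝓘(ℝ, W) ∞ (fun g => ∫ t, c t (Φ (g, ι t)) ∂μ) := by
  intro g₀
  set φ := chartAt 𝔼 g₀ with hφ
  have hφm : φ ∈ IsManifold.maximalAtlas 𝓘(ℝ, 𝔼) ∞ G := IsManifold.chart_mem_maximalAtlas g₀
  have hloc : ∀ t₀ : T, ContDiffOn ℝ ∞
      (fun p : 𝔼 × 𝔼 => Φ (φ.symm p.1, (chartAt 𝔼 (ι t₀)).symm p.2))
      (φ.target ×ˢ (chartAt 𝔼 (ι t₀)).target) := by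
    intro t₀
    rw [← contMDiffOn_iff_contDiffOn]
    have h1 : ContMDiffOn 𝓘(ℝ, 𝔼 × 𝔼) 𝓘(ℝ, 𝔼) ∞ (fun p : 𝔼 × 𝔼 => φ.symm p.1)
        (φ.target ×ˢ (chartAt 𝔼 (ι t₀)).target) :=
      (contMDiffOn_symm_of_mem_maximalAtlas hφm).comp (I' := 𝓘(ℝ, 𝔼))
        (contMDiffOn_iff_contDiffOn.2 contDiff_fst.contDiffOn) (fun p hp => hp.1)
    have h2 : ContMDiffOn 𝓘(ℝ, 𝔼 × 𝔼) 𝓘(ℝ, 𝔼) ∞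
        (fun p : 𝔼 × 𝔼 => (chartAt 𝔼 (ι t₀)).symm p.2)
        (φ.target ×ˢ (chartAt 𝔼 (ι t₀)).target) :=
      (contMDiffOn_symm_of_mem_maximalAtlas (IsManifold.chart_mem_maximalAtlas (ι t₀))).comp
        (I' := 𝓘(ℝ, 𝔼))
        (contMDiffOn_iff_contDiffOn.2 contDiff_snd.contDiffOn) (fun p hp => hp.2)
    exact hΦ.comp_contMDiffOn (h1.prodMk h2)
  have hcd : ContDiffOn ℝ ∞ (fun s => ∫ t, c t (Φ (φ.symm s, ι t)) ∂μ) φ.target := by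
    refine contDiffOn_integral_compact μ φ.open_target ?_ ?_
    · intro t
      have := (hloc t).comp (f := fun s : 𝔼 => (s, chartAt 𝔼 (ι t) (ι t))) (s := φ.target)
        (by fun_prop) (fun s hs => ⟨hs, mem_chart_target 𝔼 (ι t)⟩)
      have h2 := (c t).contDiff.comp_contDiffOn this
      refine h2.congr fun s hs => ?_
      simp only [Function.comp, (chartAt 𝔼 (ι t)).left_inv (mem_chart_source 𝔼 (ι t))]
    · rintro m ⟨s, t₀⟩ ⟨hs, -⟩
      set ψ := chartAt 𝔼 (ι t₀) with hψ
      have hSo : IsOpen (ι ⁻¹' ψ.source) := ψ.open_source.preimage hι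
      have hp := continuousOn_iteratedFDerivWithin_param φ.open_target ψ.open_target (hloc t₀)
        (S := ι ⁻¹' ψ.source) (η := fun t => ψ (ι t))
        (ψ.continuousOn.comp hι.continuousOn fun t ht => ht)
        (fun t ht => ψ.map_source ht) hc m
      have hmem : (s, t₀) ∈ φ.target ×ˢ (ι ⁻¹' ψ.source) := ⟨hs, mem_chart_source 𝔼 (ι t₀)⟩
      have hp2 := (hp.continuousAt ((φ.open_target.prod hSo).mem_nhds hmem))
      refine (hp2.congr ?_).continuousWithinAt
      filter_upwards [(φ.open_target.prod hSo).mem_nhds hmem] with p hp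
      refine iteratedFDerivWithin_congr (fun y hy => ?_) hp.1 m
      rw [ψ.left_inv hp.2]
  have h3 : ContMDiffAt 𝓘(ℝ, 𝔼) 𝓘(ℝ, W) ∞
      ((fun s => ∫ t, c t (Φ (φ.symm s, ι t)) ∂μ) ∘ φ) g₀ := by
    refine ContMDiffAt.comp g₀ (I' := 𝓘(ℝ, 𝔼)) ?_
      (contMDiffAt_of_mem_maximalAtlas hφm (mem_chart_source 𝔼 g₀))
    exact (hcd.contDiffAt (φ.open_target.mem_nhds (mem_chart_target 𝔼 g₀))).contMDiffAt
  refine h3.congr_of_eventuallyEq ?_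
  filter_upwards [φ.open_source.mem_nhds (mem_chart_source 𝔼 g₀)] with g hg
  simp only [Function.comp, φ.left_inv hg]

/-! ### Unitary representations -/

/-- A (strongly continuous) unitary representation of a topological group on `V`. -/
structure UnitaryRep (Γ V : Type*) [Group Γ] [TopologicalSpace Γ] [NormedAddCommGroup V]
    [InnerProductSpace ℂ V] extends Γ →* (V ≃ₗᵢ[ℂ] V) where
  continuous_orbit : ∀ v : V, Continuous fun g => toFun g v

namespace UnitaryRep

variable {Γ V : Type*} [Group Γ] [TopologicalSpace Γ] [NormedAddCommGroup V]
    [InnerProductSpace ℂ V]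

instance : CoeFun (UnitaryRep Γ V) (fun _ => Γ → (V ≃ₗᵢ[ℂ] V)) := ⟨fun τ => τ.toMonoidHom⟩

theorem map_mul_apply (τ : UnitaryRep Γ V) (g h : Γ) (v : V) : τ (g * h) v = τ g (τ h v) :=
  congrArg (fun T : V ≃ₗᵢ[ℂ] V => T v) (τ.toMonoidHom.map_mul g h)

theorem map_one_apply (τ : UnitaryRep Γ V) (v : V) : τ 1 v = v :=
  congrArg (fun T : V ≃ₗᵢ[ℂ] V => T v) τ.toMonoidHom.map_one

/-- The operator `τ(g)` as a bounded real-linear operator. -/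
noncomputable def toCLM (τ : UnitaryRep Γ V) (g : Γ) : V →L[ℝ] V :=
  ((τ g).toContinuousLinearEquiv : V →L[ℂ] V).restrictScalars ℝ

theorem continuous_toCLM [FiniteDimensional ℂ V] (τ : UnitaryRep Γ V) : Continuous τ.toCLM := by
  have : FiniteDimensional ℝ V := FiniteDimensional.complexToReal V
  exact continuous_clm_apply.2 τ.continuous_orbit

end UnitaryRep

/-! ### Smooth functions on a compact Lie group and their topology -/

section LieGroup

variable (𝔼 : Type*) [NormedAddCommGroup 𝔼] [NormedSpace ℝ 𝔼]
  (G : Type*) [TopologicalSpace G] [ChartedSpace 𝔼 G] [Group G]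
  (V : Type*) [NormedAddCommGroup V] [NormedSpace ℂ V]

/-- The complex vector space `C^∞(G, V)`, as a subspace of all functions. -/
def smoothFunctions : Submodule ℂ (G → V) where
  carrier := {u | ContMDiff 𝓘(ℝ, 𝔼) 𝓘(ℝ, V) ∞ u}
  zero_mem' := contMDiff_const
  add_mem' hu hv := ContMDiff.add hu hv
  smul_mem' c _ hu :=
    ((c • ContinuousLinearMap.id ℂ V).restrictScalars ℝ).contDiff.comp_contMDiff hu

/-- `C^∞(G, V)` as a type; it carries the `C^∞` topology defined below (and not the
topology of pointwise convergence). -/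
def SmoothFun : Type _ := smoothFunctions 𝔼 G V

noncomputable instance : AddCommGroup (SmoothFun 𝔼 G V) :=
  inferInstanceAs (AddCommGroup (smoothFunctions 𝔼 G V))

noncomputable instance : Module ℂ (SmoothFun 𝔼 G V) :=
  inferInstanceAs (Module ℂ (smoothFunctions 𝔼 G V))

instance : CoeFun (SmoothFun 𝔼 G V) (fun _ => G → V) := ⟨Subtype.val⟩

variable {𝔼 G V}

/-- The derivative `X u` of a function `u` along the left invariant vector field given by `X`. -/
noncomputable def leftInvDeriv (X : GroupLieAlgebra 𝓘(ℝ, 𝔼) G) (u : G → V) : G → V :=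
  fun g => mfderiv 𝓘(ℝ, 𝔼) 𝓘(ℝ, V) u g (mulInvariantVectorField X g)

/-- The iterated derivative `X₁ ⋯ X_k u` along a list of left invariant vector fields. -/
noncomputable def iterLeftInvDeriv (L : List (GroupLieAlgebra 𝓘(ℝ, 𝔼) G)) (u : G → V) : G → V :=
  L.foldr leftInvDeriv u

/-- The `C^∞` topology: uniform convergence of all derivatives `X₁ ⋯ X_k u`, `k ≥ 0`. -/
noncomputable instance : TopologicalSpace (SmoothFun 𝔼 G V) :=
  ⨅ L : List (GroupLieAlgebra 𝓘(ℝ, 𝔼) G), TopologicalSpace.induced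
    (fun u => UniformFun.ofFun (iterLeftInvDeriv L u)) (inferInstance : TopologicalSpace (UniformFun G V))

/-- The linear map `v ↦ φ ⊗ v`, where `φ ⊗ v` is the function `g ↦ φ(g) v`. -/
noncomputable def SmoothFun.tensorₗ (φ : SmoothFun 𝔼 G ℂ) : V →ₗ[ℂ] SmoothFun 𝔼 G V where
  toFun v := ⟨fun g => φ g • v,
    (((ContinuousLinearMap.id ℂ ℂ).smulRight v).restrictScalars ℝ).contDiff.comp_contMDiff φ.2⟩
  map_add' v w := Subtype.ext <| funext fun g => smul_add (φ g) v w
  map_smul' c v := Subtype.ext <| funext fun g => smul_comm (φ g) c v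

/-- The linear map `ψ ↦ (y ↦ ψ(y⁻¹x))` on `C^∞(G, V)`. -/
noncomputable def SmoothFun.reflect [LieGroup 𝓘(ℝ, 𝔼) ∞ G] (x : G) :
    SmoothFun 𝔼 G V →ₗ[ℂ] SmoothFun 𝔼 G V where
  toFun ψ := ⟨fun y => ψ (y⁻¹ * x), by
    have h : ContMDiff 𝓘(ℝ, 𝔼) 𝓘(ℝ, 𝔼) ∞ (fun y : G => y⁻¹ * x) :=
      (contMDiff_inv 𝓘(ℝ, 𝔼) ∞).mul contMDiff_const
    exact ψ.2.comp h⟩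
  map_add' _ _ := rfl
  map_smul' _ _ := rfl

end LieGroup

/-! ### Homogeneous vector bundles -/

section Bundle

variable (𝔼 : Type*) [NormedAddCommGroup 𝔼] [NormedSpace ℝ 𝔼]
  {G : Type*} [TopologicalSpace G] [ChartedSpace 𝔼 G] [Group G] {K : ClosedSubgroup G}
  {V : Type*} [NormedAddCommGroup V] [InnerProductSpace ℂ V]

/-- The smooth sections of the homogeneous vector bundle `G ×_τ V → G/K`, viewed as the smooth maps
`u : G → V` with `u(gk) = τ(k)⁻¹ u(g)`. -/
def homogeneousSections (τ : UnitaryRep K V) : Submodule ℂ (SmoothFun 𝔼 G V) where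
  carrier := {u | ∀ (g : G) (k : K), u (g * k) = τ k⁻¹ (u g)}
  zero_mem' := fun _ k => ((τ k⁻¹).map_zero).symm
  add_mem' := fun {u v} hu hv g k =>
    (congrArg₂ (· + ·) (hu g k) (hv g k)).trans ((τ k⁻¹).map_add (u g) (v g)).symm
  smul_mem' := fun c u hu g k =>
    (congrArg (c • ·) (hu g k)).trans ((τ k⁻¹).map_smul c (u g)).symm

/-- The space `Γ(E)` of smooth sections of the homogeneous vector bundle `E = G ×_τ V`, with the
`C^∞` topology. -/
def HomSection (τ : UnitaryRep K V) : Type _ := homogeneousSections 𝔼 τ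

variable (τ : UnitaryRep K V)

noncomputable instance : AddCommGroup (HomSection 𝔼 τ) :=
  inferInstanceAs (AddCommGroup (homogeneousSections 𝔼 τ))

noncomputable instance : Module ℂ (HomSection 𝔼 τ) :=
  inferInstanceAs (Module ℂ (homogeneousSections 𝔼 τ))

/-- The inclusion of `Γ(E)` into `C^∞(G, V)`. -/
noncomputable def HomSection.incl : HomSection 𝔼 τ →ₗ[ℂ] SmoothFun 𝔼 G V :=
  (homogeneousSections 𝔼 τ).subtype

noncomputable instance : TopologicalSpace (HomSection 𝔼 τ) :=
  TopologicalSpace.induced (HomSection.incl 𝔼 τ) inferInstance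

noncomputable instance : CoeFun (HomSection 𝔼 τ) (fun _ => G → V) := ⟨fun u => HomSection.incl 𝔼 τ u⟩

end Bundle

/-! ### Averaging over `K` -/

section Haar

variable (Γ : Type*) [Group Γ] [TopologicalSpace Γ] [IsTopologicalGroup Γ]
    [CompactSpace Γ] [MeasurableSpace Γ] [BorelSpace Γ]

/-- The Haar measure of total mass one on a compact group. -/
noncomputable def haarProb : Measure Γ := Measure.haarMeasure ⊤

instance : (haarProb Γ).IsHaarMeasure := inferInstanceAs (Measure.haarMeasure ⊤).IsHaarMeasure

instance : IsProbabilityMeasure (haarProb Γ) :=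
  ⟨Measure.haarMeasure_self (K₀ := (⊤ : TopologicalSpace.PositiveCompacts Γ))⟩

instance : (haarProb Γ).IsMulRightInvariant where
  map_mul_right_eq_self g := by
    have : IsProbabilityMeasure (Measure.map (· * g) (haarProb Γ)) :=
      Measure.isProbabilityMeasure_map (by fun_prop)
    exact Measure.isHaarMeasure_eq_of_isProbabilityMeasure _ _

end Haar

section Average

variable {𝔼 : Type*} [NormedAddCommGroup 𝔼] [NormedSpace ℝ 𝔼] [FiniteDimensional ℝ 𝔼]
  {G : Type*} [TopologicalSpace G] [ChartedSpace 𝔼 G] [Group G] [LieGroup 𝓘(ℝ, 𝔼) ∞ G]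
  [IsTopologicalGroup G] [CompactSpace G] [MeasurableSpace G] [BorelSpace G]

/-- Matrix coefficients of a finite dimensional unitary representation are smooth. -/
theorem UnitaryRep.contMDiff_orbit [T2Space G] {H : Type*} [NormedAddCommGroup H]
    [InnerProductSpace ℂ H] [FiniteDimensional ℂ H] (l : UnitaryRep G H) (v : H) :
    ContMDiff 𝓘(ℝ, 𝔼) 𝓘(ℝ, H) ∞ (fun g => l g v) := by
  have : CompleteSpace H := FiniteDimensional.complete ℂ H
  let W : Submodule ℂ H :=
    { carrier := {v | ContMDiff 𝓘(ℝ, 𝔼) 𝓘(ℝ, H) ∞ (fun g => l g v)}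
      zero_mem' := by simpa using contMDiff_const
      add_mem' := fun {a b} ha hb => by
        have := ContMDiff.add ha hb
        simpa [Pi.add_def] using this
      smul_mem' := fun c a ha => by
        have := ((c • ContinuousLinearMap.id ℂ H).restrictScalars ℝ).contDiff (n := ∞)
          |>.comp_contMDiff ha
        simpa [Function.comp_def] using this }
  suffices hW : v ∈ W from hW
  have hcl : IsClosed (W : Set H) := W.closed_of_finiteDimensional
  rw [← SetLike.mem_coe, ← hcl.closure_eq, Metric.mem_closure_iff]
  intro ε hε
  have hN : {g : G | dist v (l g v) < ε / 2} ∈ 𝓝 (1 : G) := by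
    have : Continuous fun g => dist v (l g v) := continuous_const.dist (l.continuous_orbit v)
    refine this.continuousAt.preimage_mem_nhds (Iio_mem_nhds ?_)
    change dist v (l 1 v) < ε / 2
    rw [l.map_one_apply]; simpa using hε
  obtain ⟨φ, -, hφ⟩ := (SmoothBumpFunction.nhds_basis_support (I := 𝓘(ℝ, 𝔼)) hN).mem_iff.1 hN
  set μ := haarProb G
  have hpos : 0 < ∫ g, φ g ∂μ :=
    φ.continuous.integral_pos_of_hasCompactSupport_nonneg_nonzero
      (HasCompactSupport.of_compactSpace _) (fun _ => φ.nonneg) (x := 1) (by simp)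
  set m := ∫ g, φ g ∂μ
  have hi1 : Integrable (fun g => φ g) μ := integrable_of_continuous_compact μ φ.continuous
  have hi2 : Integrable (fun g => φ g • l g v) μ :=
    integrable_of_continuous_compact μ (φ.continuous.smul (l.continuous_orbit v))
  have hw : (∫ g, φ g • l g v ∂μ) ∈ W := by
    have hΦ : ContMDiff (𝓘(ℝ, 𝔼).prod 𝓘(ℝ, 𝔼)) 𝓘(ℝ, ℝ) ∞
        (fun p : G × G => φ (p.1⁻¹ * p.2)) :=
      φ.contMDiff.comp (contMDiff_fst.inv.mul contMDiff_snd)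
    have h := contMDiff_integral_compact μ hΦ continuous_id
      (c := fun g => (ContinuousLinearMap.id ℝ ℝ).smulRight (l g v))
      (by
        have := l.continuous_orbit v
        exact (ContinuousLinearMap.smulRightL ℝ ℝ H (ContinuousLinearMap.id ℝ ℝ)).continuous.comp
          this)
    refine ContMDiff.congr h fun x => ?_
    have e1 : l x (∫ g, φ g • l g v ∂μ) = ∫ g, φ g • l (x * g) v ∂μ := by
      refine ((l.toCLM x).integral_comp_comm hi2).symm.trans (integral_congr_ae
        (Filter.Eventually.of_forall fun g => ?_))
      simp [UnitaryRep.toCLM]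
    rw [e1, ← integral_mul_left_eq_self (μ := μ) _ x⁻¹]
    simp
  refine ⟨m⁻¹ • ∫ g, φ g • l g v ∂μ, ?_, ?_⟩
  · have := W.smul_mem ((m⁻¹ : ℝ) : ℂ) hw
    rwa [Complex.coe_smul] at this
  · have e : v - m⁻¹ • ∫ g, φ g • l g v ∂μ = m⁻¹ • ∫ g, φ g • (v - l g v) ∂μ := by
      simp_rw [smul_sub]
      rw [integral_sub (hi1.smul_const v) hi2, integral_smul_const, smul_sub, smul_smul,
        inv_mul_cancel₀ hpos.ne', one_smul]
    rw [dist_eq_norm, e, norm_smul, norm_inv, Real.norm_of_nonneg hpos.le]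
    have hb : ‖∫ g, φ g • (v - l g v) ∂μ‖ ≤ ∫ g, φ g * (ε / 2) ∂μ := by
      refine norm_integral_le_of_norm_le (hi1.mul_const _) (Filter.Eventually.of_forall fun g => ?_)
      rw [norm_smul, Real.norm_of_nonneg φ.nonneg]
      by_cases hg : g ∈ Function.support φ
      · have : dist v (l g v) < ε / 2 := hφ hg
        exact mul_le_mul_of_nonneg_left (by simpa [dist_eq_norm] using this.le) φ.nonneg
      · rw [Function.notMem_support.1 hg]; simp
    rw [integral_mul_const] at hb
    calc m⁻¹ * _ ≤ m⁻¹ * (m * (ε / 2)) := by gcongr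
      _ = ε / 2 := by field_simp
      _ < ε := by linarith

variable {K : ClosedSubgroup G}
  {V : Type*} [NormedAddCommGroup V] [InnerProductSpace ℂ V] [FiniteDimensional ℂ V]

instance : IsTopologicalGroup K := inferInstanceAs (IsTopologicalGroup (K : Subgroup G))

theorem integrable_average (τ : UnitaryRep K V) {u : G → V} (hu : Continuous u) (g : G) :
    Integrable (fun k : K => τ k (u (g * k))) (haarProb K) :=
  integrable_of_continuous_compact _
    (τ.continuous_toCLM.clm_apply (hu.comp (continuous_const.mul continuous_subtype_val)))

/-- The projection of `C^∞(G, V)` onto `Γ(E)`, `u ↦ (g ↦ ∫_K τ(k) u(gk) dk)`. -/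
noncomputable def average (τ : UnitaryRep K V) : SmoothFun 𝔼 G V →ₗ[ℂ] HomSection 𝔼 τ where
  toFun u := ⟨⟨fun g => ∫ k : K, τ k (u (g * k)) ∂(haarProb K), by
      have : CompleteSpace V := FiniteDimensional.complete ℂ V
      have hΦ : ContMDiff (𝓘(ℝ, 𝔼).prod 𝓘(ℝ, 𝔼)) 𝓘(ℝ, V) ∞ (fun p : G × G => u (p.1 * p.2)) :=
        u.2.comp (contMDiff_fst.mul contMDiff_snd)
      exact contMDiff_integral_compact (haarProb K) hΦ continuous_subtype_val
        τ.continuous_toCLM⟩, fun g k₀ => by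
      have : CompleteSpace V := FiniteDimensional.complete ℂ V
      change ∫ k : K, τ k (u (g * k₀ * k)) ∂(haarProb K) =
        τ k₀⁻¹ (∫ k : K, τ k (u (g * k)) ∂(haarProb K))
      rw [← integral_mul_left_eq_self (μ := haarProb K) _ k₀⁻¹]
      refine Eq.trans (integral_congr_ae (Filter.Eventually.of_forall fun k => ?_))
        ((τ.toCLM k₀⁻¹).integral_comp_comm (integrable_average τ u.2.continuous g))
      change τ (k₀⁻¹ * k) (u (g * k₀ * ((k₀⁻¹ * k : K) : G))) = τ k₀⁻¹ (τ k (u (g * k)))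
      rw [τ.map_mul_apply]
      simp [mul_assoc]⟩
  map_add' u v := Subtype.ext <| Subtype.ext <| funext fun g =>
    Eq.trans (integral_congr_ae (Filter.Eventually.of_forall fun k =>
      (τ k).map_add (u (g * k)) (v (g * k))))
      (integral_add (integrable_average τ u.2.continuous g) (integrable_average τ v.2.continuous g))
  map_smul' c u := Subtype.ext <| Subtype.ext <| funext fun g =>
    Eq.trans (integral_congr_ae (Filter.Eventually.of_forall fun k =>
      (τ k).map_smul c (u (g * k)))) (integral_smul c _)

/-- Averaging fixes the sections. -/
theorem average_incl (τ : UnitaryRep K V) (u : HomSection 𝔼 τ) :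
    average τ (HomSection.incl 𝔼 τ u) = u := by
  refine Subtype.ext <| Subtype.ext <| funext fun g => ?_
  have h : ∀ k : K, τ k (u (g * k)) = u g := fun k => by
    have h1 : u (g * k) = τ k⁻¹ (u g) := u.2 g k
    rw [h1]; simp
  change ∫ k : K, τ k (u (g * k)) ∂(haarProb K) = u g
  simp_rw [h]
  simp

/-! ### Kernels and symbols -/

variable {W : Type*} [NormedAddCommGroup W] [InnerProductSpace ℂ W]
  {τ : UnitaryRep K V} {ρ : UnitaryRep K W}

/-- The Schwartz kernel `K_A(x, ·)` of an operator `A : Γ(E) → Γ(F)`, pulled back to `G × G`: for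
fixed `x` it is the `Hom(V, W)`-valued distribution on `G` whose pairing
`∫_G K_A(x, y) u(y) dy` with a test function `u ∈ C^∞(G, V)` is `A(ū)(x)`, where `ū` is the section
obtained from `u` by integration along the fibres of `G → G/K`. It represents `A` on sections and
satisfies `K_A(x, yk) = K_A(x, y) τ(k)`, as shown below. -/
noncomputable def schwartzKernel (A : HomSection 𝔼 τ →L[ℂ] HomSection 𝔼 ρ) (x : G) :
    SmoothFun 𝔼 G V →ₗ[ℂ] W :=
  LinearMap.proj x ∘ₗ (smoothFunctions 𝔼 G W).subtype ∘ₗ HomSection.incl 𝔼 ρ ∘ₗ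
    A.toLinearMap ∘ₗ average τ

/-- `A u(x) = ∫_G K_A(x, y) u(y) dy` for sections `u`. -/
theorem schwartzKernel_section (A : HomSection 𝔼 τ →L[ℂ] HomSection 𝔼 ρ) (x : G)
    (u : HomSection 𝔼 τ) : schwartzKernel A x (HomSection.incl 𝔼 τ u) = A u x := by
  change A (average τ (HomSection.incl 𝔼 τ u)) x = A u x
  rw [average_incl]

/-- `K_A(x, yk) = K_A(x, y) τ(k)` in the sense of distributions. -/
theorem schwartzKernel_right_equivariant (A : HomSection 𝔼 τ →L[ℂ] HomSection 𝔼 ρ) (x : G)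
    (k₀ : K) (u w : SmoothFun 𝔼 G V) (hw : ∀ g, w g = τ k₀ (u (g * k₀))) :
    schwartzKernel A x w = schwartzKernel A x u := by
  have : average τ w = average τ u := by
    refine Subtype.ext <| Subtype.ext <| funext fun g => ?_
    change ∫ k : K, τ k (w (g * k)) ∂(haarProb K) = ∫ k : K, τ k (u (g * k)) ∂(haarProb K)
    rw [← integral_mul_right_eq_self (μ := haarProb K) (fun k : K => τ k (u (g * k))) k₀]
    refine integral_congr_ae (Filter.Eventually.of_forall fun k => ?_)
    simp [hw, mul_assoc]
  change A (average τ w) x = A (average τ u) x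
  rw [this]

/-- The right convolution kernel `R_A(x, z) = K_A(x, x z⁻¹)`, so that
`A u(x) = ∫_G R_A(x, y⁻¹x) u(y) dy`; its pairing with `ψ` is `∫_G K_A(x, y) ψ(y⁻¹x) dy`. -/
noncomputable def convolutionKernel (A : HomSection 𝔼 τ →L[ℂ] HomSection 𝔼 ρ) (x : G) :
    SmoothFun 𝔼 G V →ₗ[ℂ] W :=
  schwartzKernel A x ∘ₗ SmoothFun.reflect x

variable [T2Space G] {H : Type*} [NormedAddCommGroup H] [InnerProductSpace ℂ H]
  [FiniteDimensional ℂ H]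

/-- The matrix coefficient `y ↦ ⟨h, l(y) h'⟩`. -/
noncomputable def matrixCoeff (l : UnitaryRep G H) (h h' : H) : SmoothFun 𝔼 G ℂ :=
  ⟨fun y => ⟪h, l y h'⟫_ℂ,
    ((innerSL ℂ h).restrictScalars ℝ).contDiff.comp_contMDiff (l.contMDiff_orbit h')⟩

/-- The matrix coefficient `y ↦ ⟨h, l(y)* h'⟩` of the adjoint. -/
noncomputable def adjointCoeff (l : UnitaryRep G H) (h h' : H) : SmoothFun 𝔼 G ℂ :=
  ⟨fun y => ⟪h, LinearMap.adjoint ((l y).toLinearEquiv : H →ₗ[ℂ] H) h'⟫_ℂ, by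
    have h1 : ContMDiff 𝓘(ℝ, 𝔼) 𝓘(ℝ, ℂ) ∞ (fun y => (starRingEnd ℂ) ⟪h', l y h⟫_ℂ) :=
      (Complex.conjCLE : ℂ →L[ℝ] ℂ).contDiff.comp_contMDiff (matrixCoeff (𝔼 := 𝔼) l h' h).2
    refine h1.congr fun y => ?_
    rw [LinearMap.adjoint_inner_right, inner_conj_symm]
    rfl⟩

/-- The Fourier coefficient `∫_G l(y)* ⊗ R(y) dy` of a `Hom(V, W)`-valued distribution `R` on `G`
at a representation `l`, computed entrywise in an orthonormal basis of the space of `l`. -/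
noncomputable def distFourierCoeff (R : SmoothFun 𝔼 G V →ₗ[ℂ] W) (l : UnitaryRep G H) :
    (H →ₗ[ℂ] H) ⊗[ℂ] (V →ₗ[ℂ] W) :=
  let h := stdOrthonormalBasis ℂ H
  ∑ m, ∑ n, (InnerProductSpace.rankOne ℂ (h m) (h n) : H →ₗ[ℂ] H) ⊗ₜ[ℂ]
    (R ∘ₗ SmoothFun.tensorₗ (adjointCoeff l (h m) (h n)))

/-- The symbol `σ_A(l, x) ∈ End(H) ⊗ Hom(V, W)`: the Fourier coefficient at `l` of the right
convolution kernel of `A` at `x`. -/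
noncomputable def opSymbol (A : HomSection 𝔼 τ →L[ℂ] HomSection 𝔼 ρ) (l : UnitaryRep G H) (x : G) :
    (H →ₗ[ℂ] H) ⊗[ℂ] (V →ₗ[ℂ] W) :=
  distFourierCoeff (convolutionKernel A x) l

/-- The component `σ_{vw} ∈ End(H)` of `σ ∈ End(H) ⊗ Hom(V, W)`: the image of `σ` under
`S ⊗ T ↦ ⟨w, T v⟩ S`. -/
noncomputable def symbolComponent (σ : (H →ₗ[ℂ] H) ⊗[ℂ] (V →ₗ[ℂ] W)) (v : V) (w : W) : H →ₗ[ℂ] H :=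
  TensorProduct.rid ℂ (H →ₗ[ℂ] H)
    (LinearMap.lTensor (H →ₗ[ℂ] H) ((innerₛₗ ℂ w) ∘ₗ LinearMap.applyₗ v) σ)

end Average

/-! The symbol formula is the identity `λ(y⁻¹x)* = λ(x)* λ(y)` read through the Schwartz kernel. The
`(m, n)` entry of `σ_A(λ, x)_{ab}` pairs `R_A(x, ·)` with `z ↦ ⟨h_m, λ(z)* h_n⟩ e_a`. By definition
of `R_A` this is `K_A(x, ·)` paired with the same function at `z = y⁻¹x`. Unitarity gives `⟨h_m,
λ(y⁻¹x)* h_n⟩ = ⟨λ(x) h_m, λ(y) h_n⟩`, and expanding in the basis `h` turns this into the finite sum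
`∑_α conj(λ_{αm}(x)) λ_{αn}(y)`. The factors depending on `x` are constants in `y`, so they leave
the kernel by linearity. What remains is `K_A(x, ·)` on `λ_{αn} e_a`, which is `A(P(λ_{αn}
e_a))(x)`.

`reflect_tensorₗ_adjointCoeff` carries this computation. The other ingredient is independence of
basis: the Fourier coefficient is defined with the standard orthonormal basis of `H`, whereas the
formula uses an arbitrary one. `inner_symbolComponent_distFourierCoeff` bridges the two by computing
matrix entries between arbitrary vectors. Only finite linear combinations of test functions occur,
so the argument is purely algebraic. -/

section SymbolFormula

variable {𝔼 : Type*} [NormedAddCommGroup 𝔼] [NormedSpace ℝ 𝔼]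
  {G : Type*} [TopologicalSpace G] [ChartedSpace 𝔼 G]
  {V W H : Type*} [NormedAddCommGroup V] [InnerProductSpace ℂ V]
  [NormedAddCommGroup W] [InnerProductSpace ℂ W]
  [NormedAddCommGroup H] [InnerProductSpace ℂ H]

/-! ### Finite sums of smooth functions and components of tensors. -/

theorem SmoothFun.ext {X : Type*} [NormedAddCommGroup X] [NormedSpace ℂ X] {u v : SmoothFun 𝔼 G X}
    (huv : ∀ g, u g = v g) : u = v :=
  Subtype.ext (funext huv)

/-- Evaluation at a point, as a linear map on `C^∞(G, X)`. -/
noncomputable def SmoothFun.evalₗ {X : Type*} [NormedAddCommGroup X] [NormedSpace ℂ X] (g : G) :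
    SmoothFun 𝔼 G X →ₗ[ℂ] X :=
  LinearMap.proj g ∘ₗ (smoothFunctions 𝔼 G X).subtype

/-- Evaluation at a point is linear. This reduces the identities between test functions below to
identities between scalars. -/
theorem SmoothFun.sum_smul_apply {X : Type*} [NormedAddCommGroup X] [NormedSpace ℂ X]
    {J : Type*} (s : Finset J) (c : J → ℂ) (u : J → SmoothFun 𝔼 G X) (g : G) :
    (∑ j ∈ s, c j • u j : SmoothFun 𝔼 G X) g = ∑ j ∈ s, c j • u j g := by
  have := map_sum (SmoothFun.evalₗ (𝔼 := 𝔼) (X := X) g) (fun j => c j • u j) s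
  simp only [map_smul] at this
  exact this

theorem symbolComponent_tmul (S : H →ₗ[ℂ] H) (T : V →ₗ[ℂ] W) (v : V) (w : W) :
    symbolComponent (S ⊗ₜ[ℂ] T) v w = ⟪w, T v⟫_ℂ • S := by
  simp [symbolComponent]

theorem symbolComponent_sum {J : Type*} (s : Finset J) (σ : J → (H →ₗ[ℂ] H) ⊗[ℂ] (V →ₗ[ℂ] W))
    (v : V) (w : W) :
    symbolComponent (∑ j ∈ s, σ j) v w = ∑ j ∈ s, symbolComponent (σ j) v w := by
  simp [symbolComponent]

/-! ### Matrix coefficients as test functions. -/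

variable [FiniteDimensional ℝ 𝔼] [Group G] [LieGroup 𝓘(ℝ, 𝔼) ∞ G] [IsTopologicalGroup G]
  [CompactSpace G] [T2Space G] [MeasurableSpace G] [BorelSpace G] [FiniteDimensional ℂ H]

theorem adjointCoeff_apply (l : UnitaryRep G H) (h h' : H) (y : G) :
    adjointCoeff (𝔼 := 𝔼) l h h' y = ⟪l y h, h'⟫_ℂ :=
  LinearMap.adjoint_inner_right _ _ _

/-- The coefficient `⟨l(y) h, h'⟩` is conjugate-linear in `h` and linear in `h'`, so its values on a
basis determine it. Since the scalars do not depend on `y`, a distribution can be applied termwise;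
this is what frees the Fourier coefficient from the basis in its definition. -/
theorem tensorₗ_adjointCoeff_eq_sum {J : Type*} [Fintype J] (s : OrthonormalBasis J ℂ H)
    (l : UnitaryRep G H) (h h' : H) (v : V) :
    SmoothFun.tensorₗ (adjointCoeff (𝔼 := 𝔼) l h h') v =
      ∑ p : J × J, (⟪h, s p.1⟫_ℂ * ⟪s p.2, h'⟫_ℂ) •
        SmoothFun.tensorₗ (adjointCoeff (𝔼 := 𝔼) l (s p.1) (s p.2)) v := by
  refine SmoothFun.ext fun y => ?_
  rw [SmoothFun.sum_smul_apply]
  change adjointCoeff (𝔼 := 𝔼) l h h' y • v =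
    ∑ p : J × J, (⟪h, s p.1⟫_ℂ * ⟪s p.2, h'⟫_ℂ) • adjointCoeff (𝔼 := 𝔼) l (s p.1) (s p.2) y • v
  simp_rw [smul_smul, ← Finset.sum_smul, adjointCoeff_apply]
  congr 1
  -- Expand `h` before applying `l y`. In the conjugate-linear slot the coefficients `⟨s p, h⟩` then
  -- become the required `⟨h, s p⟩`.
  have h1 : l y h = ∑ p, ⟪s p, h⟫_ℂ • l y (s p) := by
    conv_lhs => rw [← s.sum_repr' h]
    simp
  rw [h1, sum_inner, Fintype.sum_prod_type]
  refine Finset.sum_congr rfl fun p _ => ?_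
  -- Parseval inserts the second basis sum, between `l y (s p)` and `h'`.
  rw [inner_smul_left, inner_conj_symm, ← s.sum_inner_mul_inner (l y (s p)) h', Finset.mul_sum]
  exact Finset.sum_congr rfl fun q _ => by ring

/-- The matrix entries of a component of the Fourier coefficient of a distribution. -/
theorem inner_symbolComponent_distFourierCoeff (R : SmoothFun 𝔼 G V →ₗ[ℂ] W) (l : UnitaryRep G H)
    (v : V) (w : W) (h h' : H) :
    ⟪h, symbolComponent (distFourierCoeff R l) v w h'⟫_ℂ =
      ⟪w, R (SmoothFun.tensorₗ (adjointCoeff l h h') v)⟫_ℂ := by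
  -- Expanding in the very basis used by `distFourierCoeff` lets both sides match term by term: the
  -- rank-one operator at `(p, q)` has entry `⟨h, s p⟩ ⟨s q, h'⟩` between `h` and `h'`, where `s` is
  -- that basis.
  rw [tensorₗ_adjointCoeff_eq_sum (stdOrthonormalBasis ℂ H), map_sum, inner_sum,
    Fintype.sum_prod_type, distFourierCoeff]
  simp only [symbolComponent_sum, symbolComponent_tmul, LinearMap.sum_apply, inner_sum]
  refine Finset.sum_congr rfl fun p _ => Finset.sum_congr rfl fun q _ => ?_
  simp only [LinearMap.smul_apply, LinearMap.comp_apply, map_smul, inner_smul_right,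
    ContinuousLinearMap.coe_coe, InnerProductSpace.rankOne_apply]
  ring

/-- `l(y⁻¹x)* = l(x)* l(y)`, expressed through matrix coefficients. -/
theorem reflect_tensorₗ_adjointCoeff {J : Type*} [Fintype J] (s : OrthonormalBasis J ℂ H)
    (l : UnitaryRep G H) (x : G) (h h' : H) (v : V) :
    SmoothFun.reflect x (SmoothFun.tensorₗ (adjointCoeff (𝔼 := 𝔼) l h h') v) =
      ∑ j, (starRingEnd ℂ) ⟪s j, l x h⟫_ℂ •
        SmoothFun.tensorₗ (matrixCoeff (𝔼 := 𝔼) l (s j) h') v := by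
  refine SmoothFun.ext fun y => ?_
  rw [SmoothFun.sum_smul_apply]
  change adjointCoeff (𝔼 := 𝔼) l h h' (y⁻¹ * x) • v =
    ∑ j, (starRingEnd ℂ) ⟪s j, l x h⟫_ℂ • ⟪s j, l y h'⟫_ℂ • v
  -- Parseval collapses the right-hand sum to `⟨l x h, l y h'⟩`.
  simp_rw [smul_smul, ← Finset.sum_smul, adjointCoeff_apply, inner_conj_symm,
    s.sum_inner_mul_inner]
  -- Apply the isometry `l y` to both arguments on the left; then `y (y⁻¹ x) = x` finishes.
  rw [← (l y).inner_map_map, ← l.map_mul_apply, mul_inv_cancel_left]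

end SymbolFormula

/-! ### The symbol formula. -/

theorem mainTheorem7
    {𝔼 : Type*} [NormedAddCommGroup 𝔼] [NormedSpace ℝ 𝔼] [FiniteDimensional ℝ 𝔼]
    {G : Type*} [TopologicalSpace G] [ChartedSpace 𝔼 G] [Group G] [LieGroup 𝓘(ℝ, 𝔼) ∞ G]
    [IsTopologicalGroup G] [CompactSpace G] [T2Space G] [MeasurableSpace G] [BorelSpace G]
    (K : ClosedSubgroup G)
    {E₀ : Type*} [NormedAddCommGroup E₀] [InnerProductSpace ℂ E₀] [FiniteDimensional ℂ E₀]
    {F₀ : Type*} [NormedAddCommGroup F₀] [InnerProductSpace ℂ F₀] [FiniteDimensional ℂ F₀]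
    {H : Type*} [NormedAddCommGroup H] [InnerProductSpace ℂ H] [FiniteDimensional ℂ H]
    (τ : UnitaryRep K E₀) (ρ : UnitaryRep K F₀)
    (A : HomSection 𝔼 τ →L[ℂ] HomSection 𝔼 ρ)
    (l : UnitaryRep G H) (x : G)
    {ι κ ν : Type*} [Fintype ι] [Fintype κ] [Fintype ν]
    (e : OrthonormalBasis ι ℂ E₀) (f : OrthonormalBasis κ ℂ F₀) (h : OrthonormalBasis ν ℂ H)
    (a : ι) (b : κ) (m n : ν) :
    ⟪h m, symbolComponent (opSymbol A l x) (e a) (f b) (h n)⟫_ℂ =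
      ∑ α : ν, (starRingEnd ℂ) ⟪h α, l x (h m)⟫_ℂ *
        ⟪f b, A (average τ (SmoothFun.tensorₗ (matrixCoeff l (h α) (h n)) (e a))) x⟫_ℂ := by
  rw [opSymbol, inner_symbolComponent_distFourierCoeff]
  change ⟪f b, schwartzKernel A x
    (SmoothFun.reflect x (SmoothFun.tensorₗ (adjointCoeff l (h m) (h n)) (e a)))⟫_ℂ = _
  -- The intermediate basis is taken to be the given `h`; it supplies the index `α`.
  rw [reflect_tensorₗ_adjointCoeff h, map_sum, inner_sum]
  refine Finset.sum_congr rfl fun α _ => ?_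
  rw [map_smul, inner_smul_right]
  -- The kernel is by definition `A` after averaging, evaluated at `x`.
  rfl
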